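/- Let $\mathcal M$ be the set of monomials $M=\prod_{i\in\{1,2\},\,n\in\mathbb Z}Y_i(n)^{y_{i,n}}$ in commuting variables $Y_i(n)$, with integer exponents, almost all zero. Let $\Lambda_1,\Lambda_2$ be the fundamental weights of $G_2$ and $\mathrm{wt}(M)=\sum_{i,n}y_{i,n}\Lambda_i$. Put $$\varphi_i(M)=\max_{n\in\mathbb Z}\sum_{k\le n}y_{i,k},\qquad \varepsilon_i(M)=\max_{n\in\mathbb Z}\Big(-\sum_{k>n}y_{i,k}\Big),$$ let $n_f$ (if $\varphi_i(M)>0$) and $n_e$ (if $\varepsilon_i(M)>0$) be the smallest and the largest $n\in\mathbb Z$ with $\varphi_i(M)=\sum_{k\le n}y_{i,k}$, and let $$A_1(n)=Y_1(n)Y_1(n+1)Y_2(n)^{-1},\qquad A_2(n)=Y_2(n)Y_2(n+1)Y_1(n+1)^{-3}.$$ The Kashiwara operators are $\tilde f_iM=A_i(n_f)^{-1}M$ if $\varphi_i(M)>0$ and $\tilde f_iM=0$ otherwise, and $\tilde e_iM=A_i(n_e)M$ if $\varepsilon_i(M)>0$ and $\tilde e_iM=0$ otherwise. The crystal graph on $\mathcal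 M$ has an arrow $M\to N$ whenever $\tilde f_iM=N$ for some $i$; connected components are those of the underlying undirected graph. Let $I=\{1\prec 2\prec 3\prec 0\prec\overline 3\prec\overline 2\prec\overline 1\}$, let $\mathrm{dist}(a,b)$ be the number of steps between $a$ and $b$ in this list, and for $k\in\mathbb Z$ let $$X_1(k)=Y_1(k),\quad X_2(k)=Y_1(k+1)^{-1}Y_2(k),\quad X_3(k)=Y_1(k+1)^2Y_2(k+1)^{-1},\quad X_0(k)=Y_1(k+1)Y_1(k+2)^{-1},$$ $$X_{\overline 3}(k)=Y_1(k+2)^{-2}Y_2(k+1),\quad X_{\overline 2}(k)=Y_1(k+2)Y_2(k+2)^{-1},\quad X_{\overline 1}(k)=Y_1(k+3)^{-1}.$$ **Theorem.** Let $m,n\ge 0$ be integers and $\lambda=m\Lambda_1+n\Lambda_2$. The monomial $$M_0=Y_1(-1)^mY_2(-2)^n=X_1(-1)^m\,(X_1(-1)X_2(-2))^n$$ has weight $\lambda$ and satisfies $\tilde e_1M_0=\tilde e_2M_0=0$, and the connected component $\mathcal M'(\lambda)$ of $\mathcal M$ containing $M_0$ is the set of all monomials $$X_{a_1}(-1)\cdots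 X_{a_{m+n}}(-1)\,X_{b_1}(-2)\cdots X_{b_n}(-2)$$ with $a_j,b_j\in I$, $a_1\preceq\cdots\preceq a_{m+n}$, $b_1\preceq\cdots\preceq b_n$, satisfying the following conditions: (i) $0$ occurs at most once among $a_1,\dots,a_{m+n}$ and at most once among $b_1,\dots,b_n$; (ii) for $j=1,\dots,n$: $a_j\prec b_j$ unless $a_j=b_j=0$; (iii) for $j=1,\dots,n$: $\mathrm{dist}(a_j,b_j)\le 2$ if $a_j\in\{1,0\}$, and $\mathrm{dist}(a_j,b_j)\le 3$ otherwise; (iv) for $j=1,\dots,n-1$: $\mathrm{dist}(a_j,b_{j+1})\ge 3$ if $a_j\in\{2,3,0\}$, and $\mathrm{dist}(a_j,b_{j+1})\ge 2$ if $a_j=\overline 3$. -/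

import Mathlib

namespace G2Crystal

/-- The index set `{1, 2}` of the Dynkin diagram of type `G₂`. -/
inductive Node
  | one
  | two
  deriving DecidableEq

/-- The weight lattice `P = ℤΛ₁ ⊕ ℤΛ₂`, a weight being given by its coefficients. -/
abbrev Weight := Node → ℤ

/-- The fundamental weight `Λᵢ`. -/
def fundamentalWeight (i : Node) : Weight := Pi.single i 1

/-- Monomials `∏ Yᵢ(n)^{y_{i,n}}` in the commuting variables `Yᵢ(n)`, `i = 1, 2`, `n ∈ ℤ`, with
integer exponents, i.e. the free abelian group on the `Yᵢ(n)`, written multiplicatively. -/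
abbrev Monomial := Multiplicative ((Node × ℤ) →₀ ℤ)

/-- The exponent of `Yᵢ(n)` in the monomial `M`. -/
def expo (M : Monomial) (i : Node) (n : ℤ) : ℤ := M.toAdd (i, n)

/-- The finite set of all `n` such that `Y₁(n)` or `Y₂(n)` occurs in `M`. -/
def places (M : Monomial) : Finset ℤ := M.toAdd.support.image Prod.snd

/-- The variable `Yᵢ(n)`. -/
noncomputable def Y (i : Node) (n : ℤ) : Monomial :=
  Multiplicative.ofAdd (Finsupp.single (i, n) 1)

/-- The weight `wt(M) = ∑ᵢ (∑ₙ y_{i,n}) Λᵢ`. -/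
def wt (M : Monomial) : Weight := fun i => ∑ k ∈ places M, expo M i k

/-- The partial sum `∑_{k ≤ n} y_{i,k}`. -/
def lowerSum (i : Node) (M : Monomial) (n : ℤ) : ℤ := ∑ k ∈ places M with k ≤ n, expo M i k

/-- The partial sum `∑_{k > n} y_{i,k}`. -/
def upperSum (i : Node) (M : Monomial) (n : ℤ) : ℤ := ∑ k ∈ places M with n < k, expo M i k

/-- `φᵢ(M) = max {∑_{k ≤ n} y_{i,k} | n ∈ ℤ}`. The maximum exists (`isGreatest_phi`), and it is
nonnegative because the partial sums vanish for small `n`. -/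
noncomputable def phi (i : Node) (M : Monomial) : ℤ := ⨆ n : ℤ, lowerSum i M n

/-- `εᵢ(M) = max {-∑_{k > n} y_{i,k} | n ∈ ℤ}`. The maximum exists (`isGreatest_eps`), and it is
nonnegative because the partial sums vanish for large `n`. -/
noncomputable def eps (i : Node) (M : Monomial) : ℤ := ⨆ n : ℤ, -upperSum i M n

/-- `n_f`: the smallest `n` with `φᵢ(M) = ∑_{k ≤ n} y_{i,k}`; it exists if `φᵢ(M) > 0`
(`isLeast_placeF`). -/
noncomputable def placeF (i : Node) (M : Monomial) : ℤ := sInf {n : ℤ | phi i M = lowerSum i M n}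

/-- `n_e`: the largest `n` with `φᵢ(M) = ∑_{k ≤ n} y_{i,k}`; it exists if `εᵢ(M) > 0`
(`isGreatest_placeE`). -/
noncomputable def placeE (i : Node) (M : Monomial) : ℤ := sSup {n : ℤ | phi i M = lowerSum i M n}

/-- `A₁(n) = Y₁(n) Y₁(n+1) Y₂(n)⁻¹` and `A₂(n) = Y₂(n) Y₂(n+1) Y₁(n+1)⁻³`
(the choice `c₁₂ = 1`, `c₂₁ = 0`). -/
noncomputable def A : Node → ℤ → Monomial
  | .one, n => Y .one n * Y .one (n + 1) * (Y .two n)⁻¹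
  | .two, n => Y .two n * Y .two (n + 1) * (Y .one (n + 1) ^ 3)⁻¹

/-- The Kashiwara operator `f̃ᵢ`; the value `none` stands for `0`. -/
noncomputable def fTilde (i : Node) (M : Monomial) : Option Monomial :=
  if phi i M = 0 then none else some ((A i (placeF i M))⁻¹ * M)

/-- The Kashiwara operator `ẽᵢ`; the value `none` stands for `0`. -/
noncomputable def eTilde (i : Node) (M : Monomial) : Option Monomial :=
  if eps i M = 0 then none else some (A i (placeE i M) * M)

/-- There is an arrow from `M` to `N` in the crystal graph: `f̃ᵢ M = N` for some `i`. -/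
def Arrow (M N : Monomial) : Prop := ∃ i : Node, fTilde i M = some N

/-- The connected component of the crystal graph on all monomials that contains `M`
(arrows may be traversed in both directions). -/
def component (M : Monomial) : Set Monomial := {N | Relation.EqvGen Arrow M N}

/-- The set `I = {1, 2, 3, 0, 3̄, 2̄, 1̄}`. -/
inductive Letter
  | one
  | two
  | three
  | zero
  | bar3
  | bar2
  | bar1
  deriving DecidableEq

namespace Letter

/-- The position in the list `1, 2, 3, 0, 3̄, 2̄, 1̄`. -/
def pos : Letter → ℕ
  | one => 0
  | two => 1
  | three => 2
  | zero => 3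
  | bar3 => 4
  | bar2 => 5
  | bar1 => 6

theorem pos_injective : Function.Injective pos := by
  intro a b h
  cases a <;> cases b <;> first | rfl | exact absurd h (by decide)

/-- The linear order `1 ≺ 2 ≺ 3 ≺ 0 ≺ 3̄ ≺ 2̄ ≺ 1̄`. -/
instance : LinearOrder Letter := LinearOrder.lift' pos pos_injective

/-- The distance on `I`: `dist(i,j) = dist(j̄,ī) = j-i` for `i < j`, `dist(i,0) = dist(0,ī) = 4-i`
and `dist(i,j̄) = 8-(i+j)` for `i, j ∈ {1,2,3}`, with `dist(a,b) = dist(b,a)` and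
`dist(a,a) = 0`. -/
def dist : Letter → Letter → ℕ
  | one, two => 1
  | one, three => 2
  | two, three => 1
  | bar2, bar1 => 1
  | bar3, bar1 => 2
  | bar3, bar2 => 1
  | one, zero => 3
  | two, zero => 2
  | three, zero => 1
  | zero, bar1 => 3
  | zero, bar2 => 2
  | zero, bar3 => 1
  | one, bar1 => 6
  | one, bar2 => 5
  | one, bar3 => 4
  | two, bar1 => 5
  | two, bar2 => 4
  | two, bar3 => 3
  | three, bar1 => 4
  | three, bar2 => 3
  | three, bar3 => 2
  | two, one => 1
  | three, one => 2
  | three, two => 1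
  | bar1, bar2 => 1
  | bar1, bar3 => 2
  | bar2, bar3 => 1
  | zero, one => 3
  | zero, two => 2
  | zero, three => 1
  | bar1, zero => 3
  | bar2, zero => 2
  | bar3, zero => 1
  | bar1, one => 6
  | bar2, one => 5
  | bar3, one => 4
  | bar1, two => 5
  | bar2, two => 4
  | bar3, two => 3
  | bar1, three => 4
  | bar2, three => 3
  | bar3, three => 2
  | one, one => 0
  | two, two => 0
  | three, three => 0
  | zero, zero => 0
  | bar3, bar3 => 0
  | bar2, bar2 => 0
  | bar1, bar1 => 0

theorem dist_eq (a b : Letter) : dist a b = Nat.dist (pos a) (pos b) := by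
  cases a <;> cases b <;> rfl

end Letter

/-- The monomials `X_a(m)`, `a ∈ I`, `m ∈ ℤ`. -/
noncomputable def X : Letter → ℤ → Monomial
  | .one, m => Y .one m
  | .two, m => (Y .one (m + 1))⁻¹ * Y .two m
  | .three, m => Y .one (m + 1) ^ 2 * (Y .two (m + 1))⁻¹
  | .zero, m => Y .one (m + 1) * (Y .one (m + 2))⁻¹
  | .bar3, m => (Y .one (m + 2) ^ 2)⁻¹ * Y .two (m + 1)
  | .bar2, m => Y .one (m + 2) * (Y .two (m + 2))⁻¹
  | .bar1, m => (Y .one (m + 3))⁻¹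

/-- The conditions on the indices `a₁, …, a_{m+n}` and `b₁, …, b_n` (numbered from `0` here). -/
structure Admissible {m n : ℕ} (a : Fin (m + n) → Letter) (b : Fin n → Letter) : Prop where
  /-- `a₁ ≼ ⋯ ≼ a_{m+n}` -/
  mono_a : Monotone a
  /-- `b₁ ≼ ⋯ ≼ b_n` -/
  mono_b : Monotone b
  /-- (i) for the `a`'s: the entry `0` is not repeated -/
  zero_a : ∀ j k, a j = .zero → a k = .zero → j = k
  /-- (i) for the `b`'s: the entry `0` is not repeated -/
  zero_b : ∀ j k, b j = .zero → b k = .zero → j = k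
  /-- (ii) `a_j ≺ b_j` unless `a_j = b_j = 0`, for `1 ≤ j ≤ n` -/
  column : ∀ j : Fin n, ¬ (a (j.castLE (Nat.le_add_left n m)) = .zero ∧ b j = .zero) →
    a (j.castLE (Nat.le_add_left n m)) < b j
  /-- (iii) for `a_j ∈ {1, 0}` -/
  dist_le_two : ∀ j : Fin n,
    (a (j.castLE (Nat.le_add_left n m)) = .one ∨ a (j.castLE (Nat.le_add_left n m)) = .zero) →
    Letter.dist (a (j.castLE (Nat.le_add_left n m))) (b j) ≤ 2
  /-- (iii) for all other values of `a_j` -/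
  dist_le_three : ∀ j : Fin n,
    ¬ (a (j.castLE (Nat.le_add_left n m)) = .one ∨ a (j.castLE (Nat.le_add_left n m)) = .zero) →
    Letter.dist (a (j.castLE (Nat.le_add_left n m))) (b j) ≤ 3
  /-- (iv) for `a_j ∈ {2, 3, 0}`, `k = j + 1` -/
  three_le_dist : ∀ j k : Fin n, (j : ℕ) + 1 = k →
    (a (j.castLE (Nat.le_add_left n m)) = .two ∨ a (j.castLE (Nat.le_add_left n m)) = .three ∨
      a (j.castLE (Nat.le_add_left n m)) = .zero) →
    3 ≤ Letter.dist (a (j.castLE (Nat.le_add_left n m))) (b k)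
  /-- (iv) for `a_j = 3̄`, `k = j + 1` -/
  two_le_dist : ∀ j k : Fin n, (j : ℕ) + 1 = k →
    a (j.castLE (Nat.le_add_left n m)) = .bar3 →
    2 ≤ Letter.dist (a (j.castLE (Nat.le_add_left n m))) (b k)

/-! The maxima and minima in the definitions above exist. -/

theorem exists_bounds (M : Monomial) : ∃ L U : ℤ, ∀ k ∈ places M, L < k ∧ k ≤ U := by
  obtain ⟨U, hU⟩ := (places M).bddAbove
  obtain ⟨L, hL⟩ := (places M).bddBelow
  exact ⟨L - 1, U, fun k hk => ⟨by have := hL hk; lia, hU hk⟩⟩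

theorem lowerSum_add_upperSum (i : Node) (M : Monomial) (n : ℤ) :
    lowerSum i M n + upperSum i M n = wt M i := by
  have h := Finset.sum_filter_add_sum_filter_not (places M) (fun k => k ≤ n) (expo M i)
  simp only [not_le] at h
  exact h

theorem finite_range_lowerSum (i : Node) (M : Monomial) :
    (Set.range (lowerSum i M)).Finite := by
  refine Set.Finite.subset
    ((places M).powerset.image fun s => ∑ k ∈ s, expo M i k).finite_toSet ?_
  rintro _ ⟨n, rfl⟩
  exact Finset.mem_coe.2 (Finset.mem_image_of_mem _
    (Finset.mem_powerset.2 (Finset.filter_subset _ _)))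

theorem isGreatest_phi (i : Node) (M : Monomial) :
    IsGreatest (Set.range (lowerSum i M)) (phi i M) :=
  ⟨Int.csSup_mem (Set.range_nonempty _) (finite_range_lowerSum i M).bddAbove,
    fun _ h => le_csSup (finite_range_lowerSum i M).bddAbove h⟩

theorem isGreatest_eps (i : Node) (M : Monomial) :
    IsGreatest (Set.range fun n => -upperSum i M n) (eps i M) := by
  have hfin : (Set.range fun n => -upperSum i M n).Finite := by
    refine Set.Finite.subset ((finite_range_lowerSum i M).image fun x => x - wt M i) ?_
    rintro _ ⟨n, rfl⟩
    refine ⟨lowerSum i M n, ⟨n, rfl⟩, ?_⟩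
    have := lowerSum_add_upperSum i M n
    show lowerSum i M n - wt M i = -upperSum i M n
    lia
  exact ⟨Int.csSup_mem (Set.range_nonempty _) hfin.bddAbove,
    fun _ h => le_csSup hfin.bddAbove h⟩

/-- The relation `⟨hᵢ, wt(M)⟩ = φᵢ(M) - εᵢ(M)`. -/
theorem phi_sub_eps (i : Node) (M : Monomial) : phi i M - eps i M = wt M i := by
  obtain ⟨⟨n, hn⟩, hmax⟩ := isGreatest_phi i M
  obtain ⟨⟨k, hk⟩, hmax'⟩ := isGreatest_eps i M
  have h1 := lowerSum_add_upperSum i M n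
  have h2 := lowerSum_add_upperSum i M k
  have h3 := hmax ⟨k, rfl⟩
  have h4 := hmax' ⟨n, rfl⟩
  dsimp only at hk h4
  lia

theorem isLeast_placeF (i : Node) (M : Monomial) (h : 0 < phi i M) :
    IsLeast {n : ℤ | phi i M = lowerSum i M n} (placeF i M) := by
  obtain ⟨L, U, hb⟩ := exists_bounds M
  have hbdd : BddBelow {n : ℤ | phi i M = lowerSum i M n} := by
    refine ⟨L, fun n hn => ?_⟩
    by_contra hlt
    have hz : lowerSum i M n = 0 := by
      unfold lowerSum
      rw [Finset.filter_false_of_mem, Finset.sum_empty]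
      intro k hk
      have := (hb k hk).1
      lia
    have hn' : phi i M = lowerSum i M n := hn
    lia
  obtain ⟨⟨n, hn⟩, -⟩ := isGreatest_phi i M
  exact ⟨Int.csInf_mem ⟨n, hn.symm⟩ hbdd, fun _ hk => csInf_le hbdd hk⟩

theorem isGreatest_placeE (i : Node) (M : Monomial) (h : 0 < eps i M) :
    IsGreatest {n : ℤ | phi i M = lowerSum i M n} (placeE i M) := by
  obtain ⟨L, U, hb⟩ := exists_bounds M
  have hbdd : BddAbove {n : ℤ | phi i M = lowerSum i M n} := by
    refine ⟨U, fun n hn => ?_⟩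
    by_contra hlt
    have hz : upperSum i M n = 0 := by
      unfold upperSum
      rw [Finset.filter_false_of_mem, Finset.sum_empty]
      intro k hk
      have := (hb k hk).2
      lia
    have hn' : phi i M = lowerSum i M n := hn
    have h1 := lowerSum_add_upperSum i M n
    have h2 := phi_sub_eps i M
    lia
  obtain ⟨⟨n, hn⟩, -⟩ := isGreatest_phi i M
  exact ⟨Int.csSup_mem ⟨n, hn.symm⟩ hbdd, fun _ hk => le_csSup hbdd hk⟩

end G2Crystal

open G2Crystal

/-!
Every monomial in the component of `M₀` is a quotient `M₀ / ∏ Aᵢ(k)^{c_{i,k}}`, and the exponents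
`c` that occur are the lattice points of a polytope, namely Kashiwara's polyhedral realization of
the crystal `B(λ)`. Indeed `f̃ᵢ` increases `c` by one at a place where the exponent of `Yᵢ` is
positive, `ẽᵢ` decreases it one place to the left of a negative exponent, and these signs alone keep
`c` in the polytope; hence the component lies in it. Conversely each `ẽᵢ` raises a height function,
so climbing from a point of the polytope stops at a monomial killed by `ẽ₁` and `ẽ₂`, and looking at
the rightmost place in the support of `c` shows that `M₀` is the only such monomial.

A row of a tableau is determined by the numbers of its entries `≽ x`, for `x` in the alphabet. The
exponents `c` of the monomial of a tableau are sums of these numbers, and (i)-(iv) are inequalities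
among them. They imply the inequalities of the polytope. Conversely a point of the polytope is split
into the counting functions of the two rows by leaving up to `m` of each summand in the long row and
distributing the excess as evenly as possible.
-/

namespace G2Crystal

/-! ### Exponents, partial sums and weights -/

section Monomial

variable {M N : Monomial} {i j : Node} {k l : ℤ}

@[simp] theorem expo_one : expo 1 i k = 0 := rfl

@[simp] theorem expo_mul : expo (M * N) i k = expo M i k + expo N i k := rfl

@[simp] theorem expo_inv : expo M⁻¹ i k = -expo M i k := rfl

@[simp] theorem expo_div : expo (M / N) i k = expo M i k - expo N i k := rfl

@[simp] theorem expo_pow (r : ℕ) : expo (M ^ r) i k = r * expo M i k := by simp [expo]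

@[simp] theorem expo_zpow (r : ℤ) : expo (M ^ r) i k = r * expo M i k := by simp [expo]

theorem expo_Y : expo (Y j l) i k = if j = i ∧ l = k then 1 else 0 := by
  simp [expo, Y, Finsupp.single_apply]

theorem expo_eq_zero_of_notMem_places (h : k ∉ places M) (i : Node) : expo M i k = 0 := by
  by_contra h0
  exact h (Finset.mem_image.2 ⟨(i, k), Finsupp.mem_support_iff.2 h0, rfl⟩)

theorem lowerSum_eq_sum_of_places_subset {s : Finset ℤ} (h : places M ⊆ s) (i : Node) (n : ℤ) :
    lowerSum i M n = ∑ k ∈ s with k ≤ n, expo M i k := by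
  refine Finset.sum_subset (Finset.filter_subset_filter _ h) fun k hk hk' =>
    expo_eq_zero_of_notMem_places (fun hp => hk' ?_) i
  exact Finset.mem_filter.2 ⟨hp, (Finset.mem_filter.1 hk).2⟩

theorem wt_eq_sum_of_places_subset {s : Finset ℤ} (h : places M ⊆ s) (i : Node) :
    wt M i = ∑ k ∈ s, expo M i k :=
  Finset.sum_subset h fun _ _ hk => expo_eq_zero_of_notMem_places hk i

theorem exists_places_subset (M N : Monomial) :
    ∃ s, places M ⊆ s ∧ places N ⊆ s ∧ places (M * N) ⊆ s :=
  ⟨places M ∪ places N ∪ places (M * N), by grind, by grind, by grind⟩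

theorem places_Y_subset : places (Y j l) ⊆ {l} := by
  intro k hk
  obtain ⟨p, hp, rfl⟩ := Finset.mem_image.1 hk
  have := Finset.mem_singleton.1 (Finsupp.support_single_subset hp)
  simp [this]

theorem lowerSum_one (i : Node) (n : ℤ) : lowerSum i 1 n = 0 := by simp [lowerSum]

theorem lowerSum_mul (i : Node) (M N : Monomial) (n : ℤ) :
    lowerSum i (M * N) n = lowerSum i M n + lowerSum i N n := by
  obtain ⟨s, hM, hN, hMN⟩ := exists_places_subset M N
  simp only [lowerSum_eq_sum_of_places_subset hM, lowerSum_eq_sum_of_places_subset hN,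
    lowerSum_eq_sum_of_places_subset hMN, expo_mul, Finset.sum_add_distrib]

theorem lowerSum_inv (i : Node) (M : Monomial) (n : ℤ) :
    lowerSum i M⁻¹ n = -lowerSum i M n := by
  rw [eq_neg_iff_add_eq_zero, ← lowerSum_mul, inv_mul_cancel, lowerSum_one]

theorem lowerSum_Y (n : ℤ) : lowerSum i (Y j l) n = if j = i ∧ l ≤ n then 1 else 0 := by
  rw [lowerSum_eq_sum_of_places_subset places_Y_subset, Finset.sum_filter, Finset.sum_singleton,
    expo_Y]
  grind

theorem lowerSum_eq_lowerSum_sub_one_add_expo (i : Node) (M : Monomial) (n : ℤ) :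
    lowerSum i M n = lowerSum i M (n - 1) + expo M i n := by
  have h : places M ⊆ insert n (places M) := Finset.subset_insert _ _
  rw [lowerSum_eq_sum_of_places_subset h, lowerSum_eq_sum_of_places_subset h, add_comm,
    ← Finset.sum_insert (by simp)]
  exact Finset.sum_congr (by grind) fun _ _ => rfl

theorem exists_lowerSum_eq_zero (i : Node) (M : Monomial) (n : ℤ) :
    ∃ k < n, lowerSum i M k = 0 := by
  obtain ⟨L, _, hb⟩ := exists_bounds M
  refine ⟨min (n - 1) L, by lia, Finset.sum_eq_zero fun k hk => ?_⟩
  have := hb k (Finset.mem_filter.1 hk).1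
  have := (Finset.mem_filter.1 hk).2
  lia

theorem exists_upperSum_eq_zero (i : Node) (M : Monomial) (n : ℤ) :
    ∃ k, n < k ∧ upperSum i M k = 0 := by
  obtain ⟨_, U, hb⟩ := exists_bounds M
  refine ⟨max (n + 1) U, by lia, Finset.sum_eq_zero fun k hk => ?_⟩
  have := hb k (Finset.mem_filter.1 hk).1
  have := (Finset.mem_filter.1 hk).2
  lia

theorem upperSum_eq_expo_add_one {n : ℤ} (h : ∀ k > n + 1, expo M i k = 0) :
    upperSum i M n = expo M i (n + 1) := by
  unfold upperSum
  refine Finset.sum_eq_single _ (fun k hk hne => h k ?_) fun hn => ?_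
  · have := (Finset.mem_filter.1 hk).2
    lia
  · exact expo_eq_zero_of_notMem_places (fun hp => hn (by simp [hp])) i

theorem wt_mul (M N : Monomial) : wt (M * N) = wt M + wt N := by
  obtain ⟨s, hM, hN, hMN⟩ := exists_places_subset M N
  ext i
  simp only [Pi.add_apply, wt_eq_sum_of_places_subset hM, wt_eq_sum_of_places_subset hN,
    wt_eq_sum_of_places_subset hMN, expo_mul, Finset.sum_add_distrib]

/-- The weight as a homomorphism from the group of monomials to the weight lattice. -/
noncomputable def wtHom : Monomial →* Multiplicative Weight :=
  MonoidHom.mk' (fun M => Multiplicative.ofAdd (wt M)) fun M N => by rw [wt_mul, ofAdd_add]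

theorem wt_one : wt 1 = 0 :=
  congrArg Multiplicative.toAdd (map_one wtHom)

theorem wt_inv (M : Monomial) : wt M⁻¹ = -wt M :=
  congrArg Multiplicative.toAdd (map_inv wtHom M)

theorem wt_pow (M : Monomial) (r : ℕ) : wt (M ^ r) = r • wt M :=
  congrArg Multiplicative.toAdd (map_pow wtHom M r)

theorem wt_zpow (M : Monomial) (r : ℤ) : wt (M ^ r) = r • wt M :=
  congrArg Multiplicative.toAdd (map_zpow wtHom M r)

theorem wt_Y (i : Node) (k : ℤ) : wt (Y i k) = fundamentalWeight i := by
  ext j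
  rw [wt_eq_sum_of_places_subset places_Y_subset, Finset.sum_singleton, expo_Y, fundamentalWeight,
    Pi.single_apply]
  grind

end Monomial

/-- The pairing of `wt M` with the sum `ρ^∨` of the fundamental coweights, so that `Aᵢ(k)`,
whose weight is a simple root, has height `1`. -/
def height (M : Monomial) : ℤ := 3 * wt M .one + 5 * wt M .two

theorem height_mul (M N : Monomial) : height (M * N) = height M + height N := by
  simp only [height, wt_mul, Pi.add_apply]
  ring

theorem height_one : height 1 = 0 := by simp [height, wt_one]

theorem height_zpow (M : Monomial) (r : ℤ) : height (M ^ r) = r * height M := by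
  simp only [height, wt_zpow, Pi.smul_apply, smul_eq_mul]
  ring

theorem height_A (i : Node) (k : ℤ) : height (A i k) = 1 := by
  cases i <;> simp [height, A, wt_mul, wt_inv, wt_pow, wt_Y, fundamentalWeight]

theorem lowerSum_A_self (i : Node) (k n : ℤ) :
    lowerSum i (A i k) n = (if k ≤ n then 1 else 0) + if k + 1 ≤ n then 1 else 0 := by
  cases i <;> simp [A, pow_succ, lowerSum_mul, lowerSum_inv, lowerSum_Y]

/-! ### The Kashiwara operators -/

section Peak

variable {α β : Type*} [LT α] [Preorder β]

/-- The function `f` attains its maximum at `k`, and `k` is the first such place. -/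
def IsFirstPeak (f : α → β) (k : α) : Prop := (∀ l, f l ≤ f k) ∧ ∀ l < k, f l < f k

/-- The function `f` attains its maximum at `k`, and `k` is the last such place. -/
def IsLastPeak (f : α → β) (k : α) : Prop := (∀ l, f l ≤ f k) ∧ ∀ l, k < l → f l < f k

end Peak

theorem isFirstPeak_iff_isLeast {α β : Type*} [LinearOrder α] [PartialOrder β] {f : α → β} {b : β}
    (hb : IsGreatest (Set.range f) b) {k : α} :
    IsFirstPeak f k ↔ IsLeast {l | b = f l} k := by
  have hle (l : α) : f l ≤ b := hb.2 ⟨l, rfl⟩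
  constructor
  · rintro ⟨hmax, hlt⟩
    have hk : b = f k := hb.unique ⟨⟨k, rfl⟩, by rintro _ ⟨l, rfl⟩; exact hmax l⟩
    exact ⟨hk, fun l hl => not_lt.1 fun hlk => (hlt l hlk).ne (hl.symm.trans hk)⟩
  · rintro ⟨rfl, hleast⟩
    exact ⟨hle, fun l hl => (hle l).lt_of_ne fun h => (hleast h.symm).not_gt hl⟩

theorem isLastPeak_iff_isGreatest {α β : Type*} [LinearOrder α] [PartialOrder β] {f : α → β}
    {b : β} (hb : IsGreatest (Set.range f) b) {k : α} :
    IsLastPeak f k ↔ IsGreatest {l | b = f l} k :=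
  isFirstPeak_iff_isLeast (α := αᵒᵈ) hb

/-- Subtracting the two unit steps makes every value after `k` drop by one more than the value at
`k` and leaves the values before `k` unchanged. -/
theorem isFirstPeak_iff_isLastPeak_sub_steps {f g : ℤ → ℤ} {k : ℤ}
    (h : ∀ l, g l = f l - ((if k ≤ l then 1 else 0) + if k + 1 ≤ l then 1 else 0)) :
    IsFirstPeak f k ↔ IsLastPeak g k := by
  have hk := h k
  simp only [le_refl, if_true, add_le_iff_nonpos_right, Int.reduceLE, if_false] at hk
  constructor <;> rintro ⟨hmax, hlt⟩ <;> constructor <;> intro l <;> grind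

section Kashiwara

variable {i : Node} {M N : Monomial} {k : ℤ}

theorem phi_pos_of_isFirstPeak (h : IsFirstPeak (lowerSum i M) k) : 0 < phi i M := by
  obtain ⟨l, hl, h0⟩ := exists_lowerSum_eq_zero i M k
  rw [((isFirstPeak_iff_isLeast (isGreatest_phi i M)).1 h).1, ← h0]
  exact h.2 l hl

theorem eps_pos_of_isLastPeak (h : IsLastPeak (lowerSum i M) k) : 0 < eps i M := by
  obtain ⟨l, hl, h0⟩ := exists_upperSum_eq_zero i M k
  have hk : phi i M = lowerSum i M k := ((isLastPeak_iff_isGreatest (isGreatest_phi i M)).1 h).1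
  have := h.2 l hl
  have := lowerSum_add_upperSum i M l
  have := phi_sub_eps i M
  lia

theorem phi_nonneg (i : Node) (M : Monomial) : 0 ≤ phi i M := by
  obtain ⟨k, -, h0⟩ := exists_lowerSum_eq_zero i M 0
  exact h0 ▸ (isGreatest_phi i M).2 ⟨k, rfl⟩

theorem eps_nonneg (i : Node) (M : Monomial) : 0 ≤ eps i M := by
  obtain ⟨k, -, h0⟩ := exists_upperSum_eq_zero i M 0
  exact (isGreatest_eps i M).2 ⟨k, by simp [h0]⟩

theorem fTilde_eq_some_iff :
    fTilde i M = some N ↔ ∃ k, IsFirstPeak (lowerSum i M) k ∧ (A i k)⁻¹ * M = N := by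
  have hpeak (k : ℤ) := isFirstPeak_iff_isLeast (isGreatest_phi i M) (k := k)
  constructor
  · intro h
    obtain ⟨h0, h⟩ : ¬phi i M = 0 ∧ (A i (placeF i M))⁻¹ * M = N := by simpa [fTilde] using h
    exact ⟨_, (hpeak _).2 (isLeast_placeF i M ((phi_nonneg i M).lt_of_ne' h0)), h⟩
  · rintro ⟨k, hk, rfl⟩
    have hpos := phi_pos_of_isFirstPeak hk
    rw [fTilde, if_neg hpos.ne', (isLeast_placeF i M hpos).unique ((hpeak k).1 hk)]

theorem eTilde_eq_some_iff :
    eTilde i M = some N ↔ ∃ k, IsLastPeak (lowerSum i M) k ∧ A i k * M = N := by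
  have hpeak (k : ℤ) := isLastPeak_iff_isGreatest (isGreatest_phi i M) (k := k)
  constructor
  · intro h
    obtain ⟨h0, h⟩ : ¬eps i M = 0 ∧ A i (placeE i M) * M = N := by simpa [eTilde] using h
    exact ⟨_, (hpeak _).2 (isGreatest_placeE i M ((eps_nonneg i M).lt_of_ne' h0)), h⟩
  · rintro ⟨k, hk, rfl⟩
    have hpos := eps_pos_of_isLastPeak hk
    rw [eTilde, if_neg hpos.ne', (isGreatest_placeE i M hpos).unique ((hpeak k).1 hk)]

theorem isFirstPeak_lowerSum_iff :
    IsFirstPeak (lowerSum i M) k ↔ IsLastPeak (lowerSum i ((A i k)⁻¹ * M)) k :=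
  isFirstPeak_iff_isLastPeak_sub_steps fun l => by
    rw [lowerSum_mul, lowerSum_inv, lowerSum_A_self]
    ring

theorem fTilde_eq_some_iff_eTilde_eq_some : fTilde i M = some N ↔ eTilde i N = some M := by
  rw [fTilde_eq_some_iff, eTilde_eq_some_iff]
  refine exists_congr fun k => ⟨?_, ?_⟩
  · rintro ⟨h, rfl⟩
    exact ⟨isFirstPeak_lowerSum_iff.1 h, mul_inv_cancel_left _ _⟩
  · rintro ⟨h, rfl⟩
    exact ⟨isFirstPeak_lowerSum_iff.2 (by rwa [inv_mul_cancel_left]), inv_mul_cancel_left _ _⟩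

theorem expo_pos_of_isFirstPeak (h : IsFirstPeak (lowerSum i M) k) : 0 < expo M i k := by
  have := h.2 (k - 1) (by lia)
  have := lowerSum_eq_lowerSum_sub_one_add_expo i M k
  lia

theorem expo_add_one_neg_of_isLastPeak (h : IsLastPeak (lowerSum i M) k) :
    expo M i (k + 1) < 0 := by
  have := h.2 (k + 1) (by lia)
  have := lowerSum_eq_lowerSum_sub_one_add_expo i M (k + 1)
  grind

theorem eTilde_eq_none_iff : eTilde i M = none ↔ ∀ k, 0 ≤ upperSum i M k := by
  have h : eTilde i M = none ↔ eps i M ≤ 0 := by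
    rw [(eps_nonneg i M).ge_iff_eq']
    simp [eTilde]
  rw [h, isLUB_le_iff (isGreatest_eps i M).isLUB]
  simp [upperBounds]

theorem eTilde_eq_none_of_expo_nonneg (h : ∀ k, 0 ≤ expo M i k) : eTilde i M = none :=
  eTilde_eq_none_iff.2 fun _ => Finset.sum_nonneg fun k _ => h k

theorem expo_add_one_nonneg_of_eTilde_eq_none (h : eTilde i M = none)
    (hk : ∀ l > k + 1, expo M i l = 0) : 0 ≤ expo M i (k + 1) :=
  upperSum_eq_expo_add_one hk ▸ eTilde_eq_none_iff.1 h k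

end Kashiwara

theorem height_of_eTilde_eq_some {i : Node} {M N : Monomial} (h : eTilde i M = some N) :
    height N = height M + 1 := by
  obtain ⟨k, -, rfl⟩ := eTilde_eq_some_iff.1 h
  rw [height_mul, height_A, add_comm]

theorem component_subset {M₀ : Monomial} {S : Set Monomial} (hM₀ : M₀ ∈ S)
    (hf : ∀ M ∈ S, ∀ i N, fTilde i M = some N → N ∈ S)
    (he : ∀ M ∈ S, ∀ i N, eTilde i M = some N → N ∈ S) : component M₀ ⊆ S := by
  have hiff (M N : Monomial) (h : Relation.EqvGen Arrow M N) : M ∈ S ↔ N ∈ S := by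
    induction h with
    | rel M N h =>
      obtain ⟨i, hi⟩ := h
      exact ⟨fun hM => hf M hM i N hi,
        fun hN => he N hN i M (fTilde_eq_some_iff_eTilde_eq_some.1 hi)⟩
    | refl => rfl
    | symm _ _ _ ih => exact ih.symm
    | trans _ _ _ _ _ ih₁ ih₂ => exact ih₁.trans ih₂
  exact fun M hM => (hiff M₀ M hM).1 hM₀

/-- Climbing by the operators `ẽᵢ` raises the height, so it stops, and it can only stop at `M₀`. -/
theorem subset_component {M₀ : Monomial} {S : Set Monomial} (hS : BddAbove (height '' S))
    (he : ∀ M ∈ S, ∀ i N, eTilde i M = some N → N ∈ S)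
    (huniq : ∀ M ∈ S, (∀ i, eTilde i M = none) → M = M₀) : S ⊆ component M₀ := by
  obtain ⟨B, hB⟩ := hS
  have climb (d : ℕ) : ∀ M ∈ S, B - height M < d → Relation.EqvGen Arrow M₀ M := by
    induction d with
    | zero =>
      intro M hM hd
      have := hB ⟨M, hM, rfl⟩
      lia
    | succ d ih =>
      intro M hM hd
      by_cases htop : ∀ i, eTilde i M = none
      · rw [huniq M hM htop]
        exact .refl _
      · push Not at htop
        obtain ⟨i, hi⟩ := htop
        obtain ⟨N, hN⟩ := Option.ne_none_iff_exists'.1 hi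
        have := height_of_eTilde_eq_some hN
        exact .trans _ N _ (ih N (he M hM i N hN) (by lia))
          (.rel _ _ ⟨i, fTilde_eq_some_iff_eTilde_eq_some.2 hN⟩)
  exact fun M hM => climb (B - height M + 1).toNat M hM (by lia)

/-! ### The highest weight component as a polytope -/

/-- The exponents `c` of a product `∏ Aᵢ(k)^{c_{i,k}}`, see `prodA`. -/
abbrev AExponents := Node × ℤ →₀ ℤ

/-- The monomial `∏ Aᵢ(k)^{c_{i,k}}`. -/
noncomputable def prodA (c : AExponents) : Monomial := c.prod fun p r => A p.1 p.2 ^ r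

section prodA

variable (c d : AExponents) (i : Node) (k : ℤ)

theorem prodA_zero : prodA 0 = 1 := Finsupp.prod_zero_index

theorem prodA_add : prodA (c + d) = prodA c * prodA d :=
  Finsupp.prod_add_index' (fun _ => zpow_zero _) fun _ _ _ => zpow_add _ _ _

theorem prodA_single (r : ℤ) : prodA (.single (i, k) r) = A i k ^ r :=
  Finsupp.prod_single_index (zpow_zero _)

theorem prodA_sub : prodA (c - d) = prodA c / prodA d := by
  rw [eq_div_iff_mul_eq', ← prodA_add, sub_add_cancel]

theorem expo_one_prodA :
    expo (prodA c) .one k = c (.one, k) + c (.one, k - 1) - 3 * c (.two, k - 1) := by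
  induction c using Finsupp.induction_linear with
  | zero => simp [prodA_zero]
  | add c d hc hd =>
    simp only [prodA_add, expo_mul, hc, hd, Finsupp.add_apply]
    ring
  | single p r =>
    obtain ⟨j, l⟩ := p
    cases j <;> simp only [prodA_single, A, expo_zpow, expo_mul, expo_inv, expo_pow, expo_Y,
      Finsupp.single_apply, Prod.mk.injEq] <;> grind

theorem expo_two_prodA :
    expo (prodA c) .two k = c (.two, k) + c (.two, k - 1) - c (.one, k) := by
  induction c using Finsupp.induction_linear with
  | zero => simp [prodA_zero]
  | add c d hc hd =>
    simp only [prodA_add, expo_mul, hc, hd, Finsupp.add_apply]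
    ring
  | single p r =>
    obtain ⟨j, l⟩ := p
    cases j <;> simp only [prodA_single, A, expo_zpow, expo_mul, expo_inv, expo_pow, expo_Y,
      Finsupp.single_apply, Prod.mk.injEq] <;> grind

theorem height_prodA : height (prodA c) = c.degree := by
  induction c using Finsupp.induction_linear with
  | zero => simp [prodA_zero, height_one]
  | add c d hc hd => rw [prodA_add, height_mul, hc, hd, map_add]
  | single p r => rw [prodA_single, height_zpow, height_A, Finsupp.degree_single, mul_one]

end prodA

section Polytope

variable {i : Node} {k : ℤ} {m n : ℕ} {c : AExponents}

/-- If `k` is the right end of the support of `c`, then `y_{2,k+1} = -c (2, k)` and, if this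
vanishes, `y_{1,k+1} = -c (1, k)` are the last exponents of `M / prodA c`, hence nonnegative. -/
theorem eq_zero_of_eTilde_eq_none {M : Monomial} (hc : 0 ≤ c)
    (hM : ∀ i k, c (i, k) ≠ 0 → ∀ l > k, expo M i l = 0)
    (h : ∀ i, eTilde i (M / prodA c) = none) : c = 0 := by
  by_contra hne
  obtain ⟨⟨i, k⟩, hik, hmax⟩ :=
    c.support.exists_max_image Prod.snd (Finsupp.support_nonempty_iff.2 hne)
  have hzero (j : Node) (l : ℤ) (hl : k < l) : c (j, l) = 0 :=
    Finsupp.notMem_support_iff.1 fun hmem => (hmax _ hmem).not_gt hl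
  have htwo : c (.two, k) = 0 := by
    by_contra h0
    have hexpo (l : ℤ) (hl : k < l) : expo (M / prodA c) .two l = -c (.two, l - 1) := by
      rw [expo_div, hM _ _ h0 l hl, expo_two_prodA, hzero _ _ hl, hzero _ _ hl]
      ring
    have := expo_add_one_nonneg_of_eTilde_eq_none (h .two) (k := k) fun l hl => by
      rw [hexpo l (by lia), hzero _ _ (by lia), neg_zero]
    rw [hexpo _ (by lia), add_sub_cancel_right] at this
    exact h0 (le_antisymm (by lia) (hc _))
  have hone : c (.one, k) ≠ 0 := by
    cases i
    · exact Finsupp.mem_support_iff.1 hik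
    · exact absurd htwo (Finsupp.mem_support_iff.1 hik)
  have hexpo (l : ℤ) (hl : k < l) : expo (M / prodA c) .one l = -c (.one, l - 1) := by
    have : c (.two, l - 1) = 0 := by
      obtain rfl | hl := (show k ≤ l - 1 by lia).eq_or_lt
      exacts [htwo, hzero _ _ hl]
    rw [expo_div, hM _ _ hone l hl, expo_one_prodA, hzero _ _ hl, this]
    ring
  have := expo_add_one_nonneg_of_eTilde_eq_none (h .one) (k := k) fun l hl => by
    rw [hexpo l (by lia), hzero _ _ (by lia), neg_zero]
  rw [hexpo _ (by lia), add_sub_cancel_right] at this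
  exact hone (le_antisymm (by lia) (hc _))

/-- The monomial `M₀ = Y₁(-1)^m Y₂(-2)^n`. -/
noncomputable def highestMonomial (m n : ℕ) : Monomial := Y .one (-1) ^ m * Y .two (-2) ^ n

theorem wt_highestMonomial : wt (highestMonomial m n) =
    m • fundamentalWeight .one + n • fundamentalWeight .two := by
  simp only [highestMonomial, wt_mul, wt_pow, wt_Y]

theorem expo_one_highestMonomial :
    expo (highestMonomial m n) .one k = if k = -1 then (m : ℤ) else 0 := by
  simp [highestMonomial, expo_Y, eq_comm]

theorem expo_two_highestMonomial :
    expo (highestMonomial m n) .two k = if k = -2 then (n : ℤ) else 0 := by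
  simp [highestMonomial, expo_Y, eq_comm]

theorem eTilde_highestMonomial : eTilde i (highestMonomial m n) = none :=
  eTilde_eq_none_of_expo_nonneg fun k => by
    cases i <;> simp only [expo_one_highestMonomial, expo_two_highestMonomial] <;> positivity

/-- The lattice points `c` of the polytope that parametrizes the component of `M₀` by
`c ↦ M₀ / prodA c`. The inequalities are Kashiwara's polyhedral description of the crystal `B(λ)`
for the reduced word `(s₂s₁)³`: its coordinates `z₁, x₁, z₂, x₂, z₃, x₃` are the values of `c` at
`(2, -2)`, `(1, -1)`, `(2, -1)`, `(1, 0)`, `(2, 0)`, `(1, 1)`, and `c` vanishes elsewhere. -/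
structure InPolytope (m n : ℕ) (c : AExponents) : Prop where
  eq_zero_one : ∀ k, k < -1 ∨ 1 < k → c (.one, k) = 0
  eq_zero_two : ∀ k, k < -2 ∨ 0 < k → c (.two, k) = 0
  z₁_nonneg : 0 ≤ c (.two, -2)
  z₁_le_n : c (.two, -2) ≤ n
  x₁_le_z₁ : c (.one, -1) ≤ m + 3 * c (.two, -2)
  z₂_le_x₁ : c (.two, -1) ≤ c (.one, -1)
  z₂_le_x₁_add_m : 3 * c (.two, -1) ≤ 2 * c (.one, -1) + m
  x₂_le_z₂ : c (.one, 0) ≤ 2 * c (.two, -1)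
  x₂_le_z₂_add_m : 2 * c (.one, 0) ≤ 3 * c (.two, -1) + m
  z₃_le_x₂ : 2 * c (.two, 0) ≤ c (.one, 0)
  z₃_le_x₂_add_m : 3 * c (.two, 0) ≤ c (.one, 0) + m
  x₃_nonneg : 0 ≤ c (.one, 1)
  x₃_le_z₃ : c (.one, 1) ≤ c (.two, 0)
  x₃_le_m : c (.one, 1) ≤ m

theorem InPolytope.zero : InPolytope m n 0 := by
  constructor <;> simp

theorem InPolytope.ext {d : AExponents} (hc : InPolytope m n c) (hd : InPolytope m n d)
    (hz₁ : c (.two, -2) = d (.two, -2)) (hx₁ : c (.one, -1) = d (.one, -1))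
    (hz₂ : c (.two, -1) = d (.two, -1)) (hx₂ : c (.one, 0) = d (.one, 0))
    (hz₃ : c (.two, 0) = d (.two, 0)) (hx₃ : c (.one, 1) = d (.one, 1)) : c = d := by
  ext ⟨i, k⟩
  cases i
  · by_cases hk : k < -1 ∨ 1 < k
    · rw [hc.eq_zero_one k hk, hd.eq_zero_one k hk]
    · obtain rfl | rfl | rfl : k = -1 ∨ k = 0 ∨ k = 1 := by lia
      exacts [hx₁, hx₂, hx₃]
  · by_cases hk : k < -2 ∨ 0 < k
    · rw [hc.eq_zero_two k hk, hd.eq_zero_two k hk]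
    · obtain rfl | rfl | rfl : k = -2 ∨ k = -1 ∨ k = 0 := by lia
      exacts [hz₁, hz₂, hz₃]

theorem InPolytope.nonneg (hc : InPolytope m n c) : 0 ≤ c := by
  obtain ⟨hone, htwo⟩ := hc
  rintro ⟨i, k⟩
  simp only [Finsupp.coe_zero, Pi.zero_apply]
  cases i
  · by_cases hk : k = -1 ∨ k = 0 ∨ k = 1
    · grind
    · rw [hone k (by lia)]
  · by_cases hk : k = -2 ∨ k = -1 ∨ k = 0
    · grind
    · rw [htwo k (by lia)]

theorem expo_one_highestMonomial_div_prodA : expo (highestMonomial m n / prodA c) .one k =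
    (if k = -1 then (m : ℤ) else 0) - c (.one, k) - c (.one, k - 1) + 3 * c (.two, k - 1) := by
  rw [expo_div, expo_one_highestMonomial, expo_one_prodA]
  ring

theorem expo_two_highestMonomial_div_prodA : expo (highestMonomial m n / prodA c) .two k =
    (if k = -2 then (n : ℤ) else 0) - c (.two, k) - c (.two, k - 1) + c (.one, k) := by
  rw [expo_div, expo_two_highestMonomial, expo_two_prodA]
  ring

/-- For example, the exponent at `(2, -1)` is `x₁ - z₁ - z₂`: its positivity makes the bound
`z₂ ≤ x₁` strict, and together with `x₁ ≤ m + 3z₁` also the bound `3z₂ ≤ 2x₁ + m`. -/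
theorem InPolytope.add_single_one (hc : InPolytope m n c)
    (h : 0 < expo (highestMonomial m n / prodA c) .one k) :
    InPolytope m n (c + .single (.one, k) 1) := by
  rw [expo_one_highestMonomial_div_prodA] at h
  have hk : k = -1 ∨ k = 0 ∨ k = 1 := by
    have := hc.eq_zero_one k
    have := hc.eq_zero_two (k - 1)
    have hnonneg := hc.nonneg (.one, k - 1)
    simp only [Finsupp.coe_zero, Pi.zero_apply] at hnonneg
    lia
  cases hc
  constructor <;> simp only [Finsupp.add_apply, Finsupp.single_apply] <;> grind

theorem InPolytope.add_single_two (hc : InPolytope m n c)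
    (h : 0 < expo (highestMonomial m n / prodA c) .two k) :
    InPolytope m n (c + .single (.two, k) 1) := by
  rw [expo_two_highestMonomial_div_prodA] at h
  have hk : k = -2 ∨ k = -1 ∨ k = 0 := by
    have := hc.eq_zero_one k
    have := hc.eq_zero_two k
    have hnonneg := hc.nonneg (.two, k - 1)
    have := hc.x₃_le_z₃
    simp only [Finsupp.coe_zero, Pi.zero_apply] at hnonneg
    grind
  cases hc
  constructor <;> simp only [Finsupp.add_apply, Finsupp.single_apply] <;> grind

theorem InPolytope.sub_single_one (hc : InPolytope m n c)
    (h : expo (highestMonomial m n / prodA c) .one (k + 1) < 0) :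
    InPolytope m n (c - .single (.one, k) 1) := by
  rw [expo_one_highestMonomial_div_prodA] at h
  have hk : k = -1 ∨ k = 0 ∨ k = 1 := by
    have := hc.eq_zero_one k
    have := hc.eq_zero_one (k + 1)
    have hnonneg := hc.nonneg (.two, k)
    have := hc.x₁_le_z₁
    simp only [Finsupp.coe_zero, Pi.zero_apply] at hnonneg
    grind
  cases hc
  constructor <;> simp only [Finsupp.sub_apply, Finsupp.single_apply] <;> grind

theorem InPolytope.sub_single_two (hc : InPolytope m n c)
    (h : expo (highestMonomial m n / prodA c) .two (k + 1) < 0) :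
    InPolytope m n (c - .single (.two, k) 1) := by
  rw [expo_two_highestMonomial_div_prodA] at h
  have hk : k = -2 ∨ k = -1 ∨ k = 0 := by
    have := hc.eq_zero_two k
    have := hc.eq_zero_two (k + 1)
    have hnonneg := hc.nonneg (.one, k + 1)
    have := hc.z₁_le_n
    simp only [Finsupp.coe_zero, Pi.zero_apply] at hnonneg
    grind
  cases hc
  constructor <;> simp only [Finsupp.sub_apply, Finsupp.single_apply] <;> grind

/-- The monomials `M₀ / ∏ Aᵢ(k)^{c_{i,k}}` with `c` in the polytope `InPolytope m n`. -/
def polytopeMonomials (m n : ℕ) : Set Monomial :=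
  {M | ∃ c, InPolytope m n c ∧ highestMonomial m n / prodA c = M}

theorem highestMonomial_mem_polytopeMonomials :
    highestMonomial m n ∈ polytopeMonomials m n :=
  ⟨0, .zero, by rw [prodA_zero, div_one]⟩

theorem mem_polytopeMonomials_of_fTilde_eq_some {M N : Monomial}
    (hM : M ∈ polytopeMonomials m n) (h : fTilde i M = some N) : N ∈ polytopeMonomials m n := by
  obtain ⟨c, hc, rfl⟩ := hM
  obtain ⟨k, hk, rfl⟩ := fTilde_eq_some_iff.1 h
  have hpos := expo_pos_of_isFirstPeak hk
  refine ⟨c + .single (i, k) 1, ?_, ?_⟩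
  · cases i
    exacts [hc.add_single_one hpos, hc.add_single_two hpos]
  · rw [prodA_add, prodA_single, zpow_one, div_mul_eq_div_div, inv_mul_eq_div]

theorem mem_polytopeMonomials_of_eTilde_eq_some {M N : Monomial}
    (hM : M ∈ polytopeMonomials m n) (h : eTilde i M = some N) : N ∈ polytopeMonomials m n := by
  obtain ⟨c, hc, rfl⟩ := hM
  obtain ⟨k, hk, rfl⟩ := eTilde_eq_some_iff.1 h
  have hneg := expo_add_one_neg_of_isLastPeak hk
  refine ⟨c - .single (i, k) 1, ?_, ?_⟩
  · cases i
    exacts [hc.sub_single_one hneg, hc.sub_single_two hneg]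
  · rw [prodA_sub, prodA_single, zpow_one, div_div_eq_mul_div, mul_div_right_comm, mul_comm]

theorem bddAbove_height_polytopeMonomials : BddAbove (height '' polytopeMonomials m n) := by
  refine ⟨height (highestMonomial m n), ?_⟩
  rintro _ ⟨_, ⟨c, hc, rfl⟩, rfl⟩
  have hdeg : 0 ≤ c.degree := Finset.sum_nonneg fun p _ => hc.nonneg p
  rw [← height_prodA] at hdeg
  calc height (highestMonomial m n / prodA c)
      ≤ height (highestMonomial m n / prodA c) + height (prodA c) := le_add_of_nonneg_right hdeg
    _ = height (highestMonomial m n) := by rw [← height_mul, div_mul_cancel]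

theorem eq_highestMonomial_of_eTilde_eq_none {M : Monomial} (hM : M ∈ polytopeMonomials m n)
    (h : ∀ i, eTilde i M = none) : M = highestMonomial m n := by
  obtain ⟨c, hc, rfl⟩ := hM
  have h0 : c = 0 := by
    refine eq_zero_of_eTilde_eq_none hc.nonneg (fun i k hk l hl => ?_) h
    cases i
    · rw [expo_one_highestMonomial, if_neg]
      have := mt (hc.eq_zero_one k) hk
      lia
    · rw [expo_two_highestMonomial, if_neg]
      have := mt (hc.eq_zero_two k) hk
      lia
  rw [h0, prodA_zero, div_one]

theorem component_highestMonomial :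
    component (highestMonomial m n) = polytopeMonomials m n :=
  (component_subset highestMonomial_mem_polytopeMonomials
    (fun _ hM _ _ => mem_polytopeMonomials_of_fTilde_eq_some hM)
    (fun _ hM _ _ => mem_polytopeMonomials_of_eTilde_eq_some hM)).antisymm
  (subset_component bddAbove_height_polytopeMonomials
    (fun _ hM _ _ => mem_polytopeMonomials_of_eTilde_eq_some hM)
    (fun _ => eq_highestMonomial_of_eTilde_eq_none))

end Polytope

/-! ### Monotone rows and their counting functions -/

section CountGE

variable {α β : Type*} [LinearOrder α] [LinearOrder β]

/-- The number of entries of the row `a` that are `≥ x`. -/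
def countGE {ι : Type*} [Fintype ι] (a : ι → α) (x : α) : ℕ :=
  (Finset.univ.filter fun j => x ≤ a j).card

theorem antitone_countGE {ι : Type*} [Fintype ι] (a : ι → α) : Antitone (countGE a) :=
  fun _ _ h => Finset.card_le_card (Finset.monotone_filter_right _ fun _ _ => h.trans)

theorem countGE_bot [OrderBot α] {ι : Type*} [Fintype ι] (a : ι → α) :
    countGE a ⊥ = Fintype.card ι := by
  simp [countGE]

theorem countGE_le {N : ℕ} (a : Fin N → α) (x : α) : countGE a x ≤ N :=
  (Finset.card_le_univ _).trans_eq (Fintype.card_fin N)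

theorem card_filter_le_val_add {N P : ℕ} (hP : P ≤ N) :
    (Finset.univ.filter fun j : Fin N => N ≤ j + P).card = P := by
  have h := Finset.card_filter_add_card_filter_not (s := (Finset.univ : Finset (Fin N)))
    (fun j => (j : ℕ) < N - P)
  rw [Fin.card_filter_val_lt, Finset.card_univ, Fintype.card_fin] at h
  rw [Finset.filter_congr fun j : Fin N => fun _ => show N ≤ j + P ↔ ¬(j : ℕ) < N - P by lia]
  lia

theorem le_apply_iff {N : ℕ} {a : Fin N → α} (ha : Monotone a) (x : α) (j : Fin N) :
    x ≤ a j ↔ N ≤ j + countGE a x := by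
  constructor
  · intro h
    have hcard : (Finset.Ici j).card ≤ countGE a x := Finset.card_le_card fun k hk =>
      Finset.mem_filter.2 ⟨Finset.mem_univ _, h.trans (ha (Finset.mem_Ici.1 hk))⟩
    rw [Fin.card_Ici] at hcard
    lia
  · intro h
    by_contra hx
    have hcard : countGE a x ≤ (Finset.Ioi j).card := Finset.card_le_card fun k hk =>
      Finset.mem_Ioi.2 (lt_of_not_ge fun hkj => hx ((Finset.mem_filter.1 hk).2.trans (ha hkj)))
    rw [Fin.card_Ioi] at hcard
    lia

theorem exists_monotone_countGE_eq [Finite α] [OrderBot α] {N : ℕ} {p : α → ℕ}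
    (hp : Antitone p) (hN : p ⊥ = N) : ∃ a : Fin N → α, Monotone a ∧ countGE a = p := by
  have := Fintype.ofFinite α
  have hne (j : Fin N) : (Finset.univ.filter fun x => N ≤ j + p x).Nonempty :=
    ⟨⊥, by simp [hN]⟩
  have hle (j : Fin N) (x : α) : x ≤ Finset.max' _ (hne j) ↔ N ≤ j + p x := by
    refine ⟨fun hx => ?_, fun hx => Finset.le_max' _ _ (by simp [hx])⟩
    have := (Finset.mem_filter.1 (Finset.max'_mem _ (hne j))).2
    have := hp hx
    lia
  refine ⟨fun j => Finset.max' _ (hne j), fun j k hjk => (hle _ _).2 ?_, funext fun x => ?_⟩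
  · have := (hle j _).1 le_rfl
    have := Fin.le_iff_val_le_val.1 hjk
    lia
  · simp only [countGE, hle]
    exact card_filter_le_val_add (hN ▸ hp bot_le)

variable {m n : ℕ} {a : Fin (m + n) → α} {b : Fin n → β}

theorem forall_le_left_imp_le_right_iff (ha : Monotone a) (hb : Monotone b) (x : α) (y : β) :
    (∀ j : Fin n, x ≤ a (j.castLE (Nat.le_add_left n m)) → y ≤ b j) ↔
      countGE a x ≤ m + countGE b y := by
  simp only [le_apply_iff ha, le_apply_iff hb, Fin.val_castLE]
  refine ⟨fun h => ?_, fun h j => by lia⟩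
  by_contra!
  have := countGE_le a x
  have := h ⟨m + n - countGE a x, by lia⟩
  dsimp only at this
  lia

/-- The subtraction is truncated: if `countGE a x < m`, no entry of `b` is `≥ y`. -/
theorem forall_le_right_imp_le_left_iff (ha : Monotone a) (hb : Monotone b) (x : α) (y : β) :
    (∀ j : Fin n, y ≤ b j → x ≤ a (j.castLE (Nat.le_add_left n m))) ↔
      countGE b y ≤ countGE a x - m := by
  simp only [le_apply_iff ha, le_apply_iff hb, Fin.val_castLE]
  refine ⟨fun h => ?_, fun h j => by lia⟩
  by_contra!
  have := countGE_le b y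
  have := h ⟨n - countGE b y, by lia⟩
  dsimp only at this
  lia

theorem forall_le_left_imp_le_next_right_iff (ha : Monotone a) (hb : Monotone b) (x : α) (y : β) :
    (∀ j k : Fin n, (j : ℕ) + 1 = k → x ≤ a (j.castLE (Nat.le_add_left n m)) → y ≤ b k) ↔
      countGE a x ≤ m + countGE b y + 1 := by
  simp only [le_apply_iff ha, le_apply_iff hb, Fin.val_castLE]
  refine ⟨fun h => ?_, fun h j k => by lia⟩
  by_contra!
  have := countGE_le a x
  have := h ⟨m + n - countGE a x, by lia⟩ ⟨m + n - countGE a x + 1, by lia⟩ rfl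
  dsimp only at this
  lia

theorem forall_not_le_iff (ha : Monotone a) (x : α) :
    (∀ j : Fin n, ¬x ≤ a (j.castLE (Nat.le_add_left n m))) ↔ countGE a x ≤ m := by
  simp only [le_apply_iff ha, Fin.val_castLE]
  refine ⟨fun h => ?_, fun h j => by lia⟩
  by_contra!
  have := countGE_le a x
  have := h ⟨m + n - countGE a x, by lia⟩
  dsimp only at this
  lia

theorem forall_le_apply_iff {ι : Type*} [Fintype ι] (b : ι → β) (y : β) :
    (∀ j, y ≤ b j) ↔ countGE b y = Fintype.card ι := by
  simpa [countGE] using (Finset.card_filter_eq_iff (s := Finset.univ) (p := fun j => y ≤ b j)).symm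

end CountGE

namespace Letter

instance : Fintype Letter where
  elems := {one, two, three, zero, bar3, bar2, bar1}
  complete x := by cases x <;> decide

instance : OrderBot Letter where
  bot := one
  bot_le x := by cases x <;> decide

theorem antitone_iff {p : Letter → ℕ} : Antitone p ↔ p two ≤ p one ∧ p three ≤ p two ∧
    p zero ≤ p three ∧ p bar3 ≤ p zero ∧ p bar2 ≤ p bar3 ∧ p bar1 ≤ p bar2 := by
  refine ⟨fun h => ⟨h ?_, h ?_, h ?_, h ?_, h ?_, h ?_⟩, fun h x y hxy => ?_⟩
  any_goals decide
  cases x <;> cases y <;> first | lia | exact absurd hxy (by decide)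

theorem eq_zero_iff {x : Letter} : x = zero ↔ zero ≤ x ∧ ¬bar3 ≤ x := by
  cases x <;> decide

end Letter

theorem zero_unique_iff {ι : Type*} [Fintype ι] (a : ι → Letter) :
    (∀ j k, a j = .zero → a k = .zero → j = k) ↔ countGE a .zero ≤ countGE a .bar3 + 1 := by
  classical
  have hsub : (Finset.univ.filter fun j => Letter.bar3 ≤ a j) ⊆
      Finset.univ.filter fun j => Letter.zero ≤ a j :=
    Finset.monotone_filter_right _ fun j _ h => le_trans (by decide) h
  have hcard := Finset.card_sdiff_add_card_eq_card hsub
  have hone : (∀ j k, a j = .zero → a k = .zero → j = k) ↔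
      ((Finset.univ.filter fun j => Letter.zero ≤ a j) \
        Finset.univ.filter fun j => Letter.bar3 ≤ a j).card ≤ 1 := by
    simp only [Finset.card_le_one, Finset.mem_sdiff, Finset.mem_filter, Finset.mem_univ, true_and,
      ← Letter.eq_zero_iff]
    exact ⟨fun h j hj k => h j k hj, fun h j k hj => h j hj k⟩
  rw [hone]
  unfold countGE
  lia

/-- The conditions (ii) and (iii) on entries `x = a_j` and `y = b_j`. -/
def IsColumn (x y : Letter) : Prop :=
  (¬(x = .zero ∧ y = .zero) → x < y) ∧ (x = .one ∨ x = .zero → Letter.dist x y ≤ 2) ∧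
    (¬(x = .one ∨ x = .zero) → Letter.dist x y ≤ 3)

/-- The condition (iv) on entries `x = a_j` and `z = b_{j+1}`. -/
def IsDiagonal (x z : Letter) : Prop :=
  (x = .two ∨ x = .three ∨ x = .zero → 3 ≤ Letter.dist x z) ∧ (x = .bar3 → 2 ≤ Letter.dist x z)

theorem isColumn_iff {x y : Letter} : IsColumn x y ↔
    .two ≤ y ∧ (.zero ≤ y → .two ≤ x) ∧ (.bar2 ≤ y → .three ≤ x) ∧ (.bar1 ≤ y → .bar3 ≤ x) ∧
      (.two ≤ x → .three ≤ y) ∧ (.three ≤ x → .zero ≤ y) ∧ (.bar3 ≤ x → .bar2 ≤ y) ∧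
      (.bar2 ≤ x → .bar1 ≤ y) ∧ ¬.bar1 ≤ x := by
  unfold IsColumn
  cases x <;> cases y <;> decide

theorem isDiagonal_iff {x y z : Letter} (hxy : IsColumn x y) (hyz : y ≤ z) : IsDiagonal x z ↔
    (.two ≤ x → .bar3 ≤ z) ∧ (.three ≤ x → .bar2 ≤ z) ∧ (.zero ≤ x → .bar1 ≤ z) := by
  unfold IsColumn at hxy
  unfold IsDiagonal
  revert x y z
  decide

/-- The conditions on a tableau in terms of the numbers `p x` and `q x` of entries `≽ x` in its rows
of lengths `m + n` and `n`. The subtractions are truncated. -/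
structure AdmissibleCounts (m n : ℕ) (p q : Letter → ℕ) : Prop where
  antitone_p : Antitone p
  antitone_q : Antitone q
  p_one : p .one = m + n
  q_one : q .one = n
  zero_p : p .zero ≤ p .bar3 + 1
  zero_q : q .zero ≤ q .bar3 + 1
  q_two : q .two = n
  q_zero_le : q .zero ≤ p .two - m
  q_bar2_le : q .bar2 ≤ p .three - m
  q_bar1_le : q .bar1 ≤ p .bar3 - m
  p_two_le : p .two ≤ m + q .three
  p_three_le : p .three ≤ m + q .zero
  p_bar3_le : p .bar3 ≤ m + q .bar2
  p_bar2_le : p .bar2 ≤ m + q .bar1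
  p_bar1_le : p .bar1 ≤ m
  p_two_le' : p .two ≤ m + q .bar3 + 1
  p_three_le' : p .three ≤ m + q .bar2 + 1
  p_zero_le : p .zero ≤ m + q .bar1 + 1

section Admissible

variable {m n : ℕ} {a : Fin (m + n) → Letter} {b : Fin n → Letter}

theorem admissible_iff_isColumn_isDiagonal : Admissible a b ↔ Monotone a ∧ Monotone b ∧
    (∀ j k, a j = .zero → a k = .zero → j = k) ∧ (∀ j k, b j = .zero → b k = .zero → j = k) ∧
    (∀ j : Fin n, IsColumn (a (j.castLE (Nat.le_add_left n m))) (b j)) ∧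
    ∀ j k : Fin n, (j : ℕ) + 1 = k → IsDiagonal (a (j.castLE (Nat.le_add_left n m))) (b k) :=
  ⟨fun h => ⟨h.mono_a, h.mono_b, h.zero_a, h.zero_b,
      fun j => ⟨h.column j, h.dist_le_two j, h.dist_le_three j⟩,
      fun j k hjk => ⟨h.three_le_dist j k hjk, h.two_le_dist j k hjk⟩⟩,
    fun ⟨ha, hb, hza, hzb, hcol, hdiag⟩ => ⟨ha, hb, hza, hzb, fun j => (hcol j).1,
      fun j => (hcol j).2.1, fun j => (hcol j).2.2, fun j k hjk => (hdiag j k hjk).1,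
      fun j k hjk => (hdiag j k hjk).2⟩⟩

theorem forall_isColumn_iff (ha : Monotone a) (hb : Monotone b) :
    (∀ j : Fin n, IsColumn (a (j.castLE (Nat.le_add_left n m))) (b j)) ↔
      countGE b .two = n ∧ countGE b .zero ≤ countGE a .two - m ∧
      countGE b .bar2 ≤ countGE a .three - m ∧ countGE b .bar1 ≤ countGE a .bar3 - m ∧
      countGE a .two ≤ m + countGE b .three ∧ countGE a .three ≤ m + countGE b .zero ∧
      countGE a .bar3 ≤ m + countGE b .bar2 ∧ countGE a .bar2 ≤ m + countGE b .bar1 ∧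
      countGE a .bar1 ≤ m := by
  simp only [isColumn_iff, forall_and, forall_le_apply_iff, forall_le_left_imp_le_right_iff ha hb,
    forall_le_right_imp_le_left_iff ha hb, forall_not_le_iff ha, Fintype.card_fin]

theorem forall_isDiagonal_iff (ha : Monotone a) (hb : Monotone b)
    (h : ∀ j : Fin n, IsColumn (a (j.castLE (Nat.le_add_left n m))) (b j)) :
    (∀ j k : Fin n, (j : ℕ) + 1 = k →
        IsDiagonal (a (j.castLE (Nat.le_add_left n m))) (b k)) ↔
      countGE a .two ≤ m + countGE b .bar3 + 1 ∧ countGE a .three ≤ m + countGE b .bar2 + 1 ∧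
      countGE a .zero ≤ m + countGE b .bar1 + 1 := by
  have hdiag (j k : Fin n) (hjk : (j : ℕ) + 1 = k) :=
    isDiagonal_iff (h j) (hb (show j ≤ k from Fin.le_iff_val_le_val.2 (by lia)))
  simp +contextual only [hdiag, forall_and, forall_le_left_imp_le_next_right_iff ha hb]

theorem admissible_iff : Admissible a b ↔
    Monotone a ∧ Monotone b ∧ AdmissibleCounts m n (countGE a) (countGE b) := by
  rw [admissible_iff_isColumn_isDiagonal]
  refine and_congr_right fun ha => and_congr_right fun hb => ?_
  rw [zero_unique_iff, zero_unique_iff]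
  constructor
  · rintro ⟨hza, hzb, hcol, hdiag⟩
    obtain ⟨h₁, h₂, h₃, h₄, h₅, h₆, h₇, h₈, h₉⟩ := (forall_isColumn_iff ha hb).1 hcol
    obtain ⟨h₁₀, h₁₁, h₁₂⟩ := (forall_isDiagonal_iff ha hb hcol).1 hdiag
    exact ⟨antitone_countGE a, antitone_countGE b, (countGE_bot a).trans (Fintype.card_fin _),
      (countGE_bot b).trans (Fintype.card_fin _), hza, hzb, h₁, h₂, h₃, h₄, h₅, h₆, h₇, h₈, h₉,
      h₁₀, h₁₁, h₁₂⟩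
  · intro h
    have hcol := (forall_isColumn_iff ha hb).2 ⟨h.q_two, h.q_zero_le, h.q_bar2_le, h.q_bar1_le,
      h.p_two_le, h.p_three_le, h.p_bar3_le, h.p_bar2_le, h.p_bar1_le⟩
    exact ⟨h.zero_p, h.zero_q, hcol,
      (forall_isDiagonal_iff ha hb hcol).2 ⟨h.p_two_le', h.p_three_le', h.p_zero_le⟩⟩

end Admissible

/-! ### Tableaux and lattice points -/

theorem monomial_ext {M N : Monomial} (h : ∀ i k, expo M i k = expo N i k) : M = N :=
  Finsupp.ext fun p => h p.1 p.2

/-- The exponents of `∏ Y₁(k) / X_a(k)`, the product being over the entries `a` of a row with `p x`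
entries `≽ x`, as a product of the `Aᵢ(l)`. -/
noncomputable def rowExponent (p : Letter → ℕ) (k : ℤ) : AExponents :=
  .single (.one, k) (p .two) + .single (.two, k) (p .three) +
    .single (.one, k + 1) (p .zero + p .bar3) + .single (.two, k + 1) (p .bar2) +
    .single (.one, k + 2) (p .bar1)

theorem prodA_rowExponent (p : Letter → ℕ) (k : ℤ) :
    prodA (rowExponent p k) = A .one k ^ p .two * A .two k ^ p .three *
      A .one (k + 1) ^ (p .zero + p .bar3) * A .two (k + 1) ^ p .bar2 *
      A .one (k + 2) ^ p .bar1 := by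
  simp only [rowExponent, prodA_add, prodA_single, zpow_natCast, ← Nat.cast_add]

theorem X_eq_div_prodA (x : Letter) (k : ℤ) :
    X x k = Y .one k / prodA (rowExponent (fun y => if y ≤ x then 1 else 0) k) := by
  have h2 : k + 1 + 1 = k + 2 := by ring
  have h3 : k + 2 + 1 = k + 3 := by ring
  have hle (x y : Letter) : x ≤ y ↔ x.pos ≤ y.pos := Iff.rfl
  refine monomial_ext fun i l => ?_
  cases x <;> simp [prodA_rowExponent, X, A, h2, h3, hle, Letter.pos] <;> ring

theorem prod_X_eq_div_prodA {ι : Type*} [Fintype ι] (a : ι → Letter) (k : ℤ) :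
    ∏ j, X (a j) k = Y .one k ^ Fintype.card ι / prodA (rowExponent (countGE a) k) := by
  simp only [X_eq_div_prodA, prodA_rowExponent, Finset.prod_div_distrib, Finset.prod_const,
    Finset.card_univ, Finset.prod_mul_distrib, Finset.prod_pow_eq_pow_sum, Finset.sum_add_distrib,
    countGE, Finset.card_filter]

/-- The exponents of `M₀ / M` as a product of the `Aᵢ(k)`, where `M` is the monomial of a tableau
with `p x` and `q x` entries `≽ x` in its rows of lengths `m + n` and `n`. -/
noncomputable def tableauExponent (n : ℕ) (p q : Letter → ℕ) : AExponents :=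
  rowExponent p (-1) + rowExponent q (-2) - .single (.one, -2) (n : ℤ)

section Tableau

variable {m n : ℕ} {p q : Letter → ℕ}

theorem prod_X_mul_prod_X (a : Fin (m + n) → Letter) (b : Fin n → Letter) :
    (∏ j, X (a j) (-1)) * ∏ j, X (b j) (-2) =
      highestMonomial m n / prodA (tableauExponent n (countGE a) (countGE b)) := by
  have hA : Y .one (-1) * Y .one (-2) = A .one (-2) * Y .two (-2) := by
    simp only [A, inv_mul_cancel_right]
    exact mul_comm _ _
  simp only [prod_X_eq_div_prodA, tableauExponent, prodA_sub, prodA_add, prodA_single,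
    Fintype.card_fin, zpow_natCast, highestMonomial]
  rw [div_mul_div_comm, pow_add, mul_assoc, ← mul_pow, hA, mul_pow, div_div_eq_mul_div]
  congr 1
  rw [mul_assoc, mul_comm (A _ _ ^ n)]

theorem AdmissibleCounts.inPolytope (h : AdmissibleCounts m n p q) :
    InPolytope m n (tableauExponent n p q) := by
  have hp := Letter.antitone_iff.1 h.antitone_p
  have hq := Letter.antitone_iff.1 h.antitone_q
  cases h
  constructor <;> simp only [tableauExponent, rowExponent, Finsupp.add_apply, Finsupp.sub_apply,
    Finsupp.single_apply, Prod.mk.injEq] <;> grind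

/-- The summand `p`, counted in the long row, absorbs up to `m`, and the excess of `x` is
distributed as evenly as possible. -/
theorem exists_balanced_sum_of_long_short_short (m x : ℕ) : ∃ p q r : ℕ, x = p + q + r ∧
    r ≤ q ∧ q ≤ r + 1 ∧ q ≤ p - m ∧ p ≤ m + r + 1 :=
  ⟨min x m + (x - m + 2) / 3, (x - m + 1) / 3, (x - m) / 3, by lia⟩

theorem exists_balanced_sum_of_long_short (m x : ℕ) : ∃ p q : ℕ, x = p + q ∧
    q ≤ p - m ∧ p ≤ m + q + 1 :=
  ⟨min x m + (x - m + 1) / 2, (x - m) / 2, by lia⟩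

theorem exists_balanced_sum_of_long_long_short (m x : ℕ) : ∃ p q r : ℕ, x = p + q + r ∧
    q ≤ p ∧ p ≤ q + 1 ∧ r ≤ q - m ∧ p ≤ m + r + 1 :=
  ⟨(min x (2 * m) + 1) / 2 + (x - 2 * m + 2) / 3, min x (2 * m) / 2 + (x - 2 * m + 1) / 3,
    (x - 2 * m) / 3, by lia⟩

theorem InPolytope.exists_admissibleCounts {c : AExponents} (hc : InPolytope m n c) :
    ∃ p q, AdmissibleCounts m n p q ∧ tableauExponent n p q = c := by
  obtain ⟨x₁, hx₁⟩ := Int.eq_ofNat_of_zero_le (hc.nonneg (.one, -1))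
  obtain ⟨x₂, hx₂⟩ := Int.eq_ofNat_of_zero_le (hc.nonneg (.one, 0))
  obtain ⟨x₃, hx₃⟩ := Int.eq_ofNat_of_zero_le (hc.nonneg (.one, 1))
  obtain ⟨z₁, hz₁⟩ := Int.eq_ofNat_of_zero_le (hc.nonneg (.two, -2))
  obtain ⟨z₂, hz₂⟩ := Int.eq_ofNat_of_zero_le (hc.nonneg (.two, -1))
  obtain ⟨z₃, hz₃⟩ := Int.eq_ofNat_of_zero_le (hc.nonneg (.two, 0))
  obtain ⟨p₂, q₀, q₃', rfl, h₁, h₂, h₃, h₄⟩ := exists_balanced_sum_of_long_short_short m x₁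
  obtain ⟨p₃, q₂', rfl, h₅, h₆⟩ := exists_balanced_sum_of_long_short m z₂
  obtain ⟨p₀, p₃', q₁', rfl, h₇, h₈, h₉, h₁₀⟩ := exists_balanced_sum_of_long_long_short m x₂
  let p : Letter → ℕ
    | .one => m + n | .two => p₂ | .three => p₃ | .zero => p₀ | .bar3 => p₃' | .bar2 => z₃
    | .bar1 => x₃
  let q : Letter → ℕ
    | .one => n | .two => n | .three => z₁ | .zero => q₀ | .bar3 => q₃' | .bar2 => q₂'
    | .bar1 => q₁'
  have hpq : AdmissibleCounts m n p q := by
    cases hc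
    constructor <;> simp only [Letter.antitone_iff, p, q] <;> lia
  refine ⟨p, q, hpq, hpq.inPolytope.ext hc ?_ ?_ ?_ ?_ ?_ ?_⟩ <;>
    simp [tableauExponent, rowExponent, p, q, *, add_assoc]

theorem polytopeMonomials_eq_setOf_admissible :
    polytopeMonomials m n = {M | ∃ (a : Fin (m + n) → Letter) (b : Fin n → Letter),
      Admissible a b ∧ M = (∏ j, X (a j) (-1)) * ∏ j, X (b j) (-2)} := by
  ext M
  constructor
  · rintro ⟨c, hc, rfl⟩
    obtain ⟨p, q, hpq, rfl⟩ := hc.exists_admissibleCounts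
    obtain ⟨a, ha, rfl⟩ := exists_monotone_countGE_eq hpq.antitone_p hpq.p_one
    obtain ⟨b, hb, rfl⟩ := exists_monotone_countGE_eq hpq.antitone_q hpq.q_one
    exact ⟨a, b, admissible_iff.2 ⟨ha, hb, hpq⟩, (prod_X_mul_prod_X a b).symm⟩
  · rintro ⟨a, b, hab, rfl⟩
    exact ⟨_, (admissible_iff.1 hab).2.2.inPolytope, (prod_X_mul_prod_X a b).symm⟩

end Tableau

end G2Crystal

theorem mainTheorem4 (m n : ℕ) :
    wt (Y .one (-1) ^ m * Y .two (-2) ^ n) =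
        m • fundamentalWeight .one + n • fundamentalWeight .two ∧
      (∀ i : Node, eTilde i (Y .one (-1) ^ m * Y .two (-2) ^ n) = none) ∧
      Y .one (-1) ^ m * Y .two (-2) ^ n = X .one (-1) ^ m * (X .one (-1) * X .two (-2)) ^ n ∧
      component (Y .one (-1) ^ m * Y .two (-2) ^ n) =
        {M : Monomial | ∃ (a : Fin (m + n) → Letter) (b : Fin n → Letter),
          Admissible a b ∧ M = (∏ j, X (a j) (-1)) * ∏ j, X (b j) (-2)} := by
  have hX : highestMonomial m n = X .one (-1) ^ m * (X .one (-1) * X .two (-2)) ^ n := by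
    simp [highestMonomial, X]
  exact ⟨wt_highestMonomial, fun _ => eTilde_highestMonomial, hX,
    component_highestMonomial.trans polytopeMonomials_eq_setOf_admissible⟩
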